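/- Let $d\in\mathbb{N}$ and $[d]=\{1,\dots,d\}$. For a countable Abelian group $\Gamma$, a \emph{$\Gamma$-system} $\mathbf{X}=(X,\Sigma,\mu,T)$ is an action $T$ of $\Gamma$ by measurable $\mu$-preserving transformations $T^\gamma$ of a standard Borel probability space $(X,\Sigma,\mu)$. A \emph{factor map} $\pi:\mathbf{Y}\to\mathbf{X}$ is a measurable, measure-preserving, $\Gamma$-equivariant map; $\mathbf{Y}$ is then called an \emph{extension} of $\mathbf{X}$. If $\Sigma_1,\Sigma_2\supseteq\Xi$ are $\sigma$-subalgebras of a probability space $(\Omega,\mathcal{A},\lambda)$, then $\Sigma_1$ and $\Sigma_2$ are \emph{relatively independent over $\Xi$} if $\int f_1f_2\,d\lambda=\int \mathsf{E}(f_1\,|\,\Xi)\,\mathsf{E}(f_2\,|\,\Xi)\,d\lambda$ for all $f_i\in L^\infty(\lambda)$ that are $\Sigma_i$-measurable, $i=1,2$. For a subgroup $\Lambda\le\Gamma$, let $\mathsf{Z}_0^\Lambda$ be the class of $\Gamma$-systems on which every $\gamma\in\Lambda$ acts as the identity almost everywhere, and let $\Sigma^{T\upharpoonright\Lambda}$ be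 the $\sigma$-algebra of all $A\in\Sigma$ with $\mu(A\triangle T^\gamma A)=0$ for all $\gamma\in\Lambda$. The join $\bigvee_j\mathsf{C}_j$ of classes is the class of all systems that admit factor maps to members of the classes $\mathsf{C}_j$, one for each $j$, which together generate the whole $\sigma$-algebra modulo null sets (the join of no classes is the class of trivial systems). For a class $\mathsf{C}$ of this kind, every system $\mathbf{X}$ has a maximal $\sigma$-subalgebra (unique modulo null sets) that is generated by a factor map to a member of $\mathsf{C}$, called the \emph{maximal $\mathsf{C}$-factor} of $\mathbf{X}$. The system $\mathbf{X}$ is \emph{$\mathsf{C}$-sated} if for every extension $\pi:\mathbf{Y}\to\mathbf{X}$ the $\sigma$-algebra $\pi^{-1}(\Sigma)$ and the maximal $\mathsf{C}$-factor of $\mathbf{Y}$ are relatively independent over the preimage under $\pi$ of the maximal $\mathsf{C}$-factor of $\mathbf{X}$. Now let $\mathbf{X}=(X,\Sigma,\mu,T)$ be a $\mathbb{Z}^d$-system and let $\mathbf{e}_1,\dots,\mathbf{e}_d$ be the standard basis of $\mathbb{Z}^d$. For $a\subseteq[d]$ let $\Gamma_a\le\mathbb{Z}^d$ be the subgroup generated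 by all $\mathbf{e}_i-\mathbf{e}_l$ with $i,l\in a$. For non-empty $e\subseteq[d]$ put $$\mathsf{C}_e:=\bigvee_{j\in[d]\setminus e}\mathsf{Z}_0^{\Gamma_{e\cup\{j\}}}.$$ The \emph{Furstenberg self-joining} $\mu^{\mathrm{F}}$ of $\mathbf{X}$ is the probability measure on $X^d$ determined by $$\mu^{\mathrm{F}}(A_1\times\cdots\times A_d)=\lim_{N\to\infty}\frac1N\sum_{n=1}^N\mu\big(T^{-n\mathbf{e}_1}(A_1)\cap\cdots\cap T^{-n\mathbf{e}_d}(A_d)\big)\qquad(A_1,\dots,A_d\in\Sigma)$$ (it is known that these limits exist and define such a measure). Let $\pi_i:X^d\to X$ be the coordinate projections. For $e\subseteq[d]$ with $|e|\ge2$ let $\Phi_e:=\Sigma^{T\upharpoonright\Gamma_e}$ and let the \emph{oblique copy} $\Phi^{\mathrm{F}}_e$ be the common $\mu^{\mathrm{F}}$-completion, within the product $\sigma$-algebra of $X^d$, of the $\sigma$-algebras $\pi_i^{-1}(\Phi_e)$, $i\in e$ (these agree modulo $\mu^{\mathrm{F}}$-null sets). Let $\binom{[d]}{\ge2}$ be the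 family of all subsets of $[d]$ with at least two elements; $\mathcal{I}\subseteq\binom{[d]}{\ge2}$ is an \emph{up-set} if $u\in\mathcal{I}$ and $u\subseteq v\subseteq[d]$ imply $v\in\mathcal{I}$, and for such $\mathcal{I}$ let the \emph{oblique factor} $\Phi^{\mathrm{F}}_{\mathcal{I}}$ be the $\sigma$-algebra generated by all $\Phi^{\mathrm{F}}_e$ with $e\in\mathcal{I}$. \textbf{Proposition.} Suppose that $\mathbf{X}$ is $\mathsf{C}_e$-sated for every non-empty $e\subseteq[d]$. Then for all up-sets $\mathcal{I},\mathcal{I}'\subseteq\binom{[d]}{\ge2}$ the oblique factors $\Phi^{\mathrm{F}}_{\mathcal{I}}$ and $\Phi^{\mathrm{F}}_{\mathcal{I}'}$ are relatively independent over $\Phi^{\mathrm{F}}_{\mathcal{I}\cap\mathcal{I}'}$ under $\mu^{\mathrm{F}}$. -/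

import Mathlib

open MeasureTheory Filter Topology
open scoped ENNReal

universe u v

/-- A probability-preserving system: an action `T` of the discrete group `Γ` by measurable,
measure-preserving transformations of a standard Borel probability space. -/
structure PPSystem (Γ : Type v) [AddGroup Γ] where
  /-- The underlying space. -/
  carrier : Type u
  /-- Its Borel sigma-algebra. -/
  [mspace : MeasurableSpace carrier]
  [standardBorel : StandardBorelSpace carrier]
  /-- The invariant probability measure. -/
  μ : Measure carrier
  [prob : IsProbabilityMeasure μ]
  /-- The action. -/
  T : Γ → carrier → carrier
  T_zero : T 0 = id
  T_add : ∀ g h : Γ, T (g + h) = T g ∘ T h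
  measurePreserving : ∀ g : Γ, MeasurePreserving (T g) μ μ

namespace PPSystem

attribute [instance] PPSystem.mspace PPSystem.standardBorel PPSystem.prob

variable {Γ : Type v} [AddGroup Γ]

/-- `π` is a factor map from the system `X` to the system `Y`
(equivalently, `X` is an extension of `Y` through `π`). -/
structure IsFactorMap (X Y : PPSystem.{u} Γ) (π : X.carrier → Y.carrier) : Prop where
  measurePreserving : MeasurePreserving π X.μ Y.μ
  equivariant : ∀ g : Γ, π ∘ X.T g = Y.T g ∘ π

/-- The class of systems on which the subaction of `Λ` is (almost everywhere) trivial. -/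
def ClassZ0 (Λ : AddSubgroup Γ) (Y : PPSystem.{u} Γ) : Prop :=
  ∀ g ∈ Λ, Y.T g =ᵐ[Y.μ] id

/-- The join of a family of classes of systems: the class of all joinings of members of these
classes, that is, of all systems `Y` with factor maps to systems `Z i` in the class `C i`
such that these factor maps together generate the whole sigma-algebra of `Y`, up to null sets.
The join of the empty family consists of the trivial systems. -/
def ClassJoin {ι : Type*} (C : ι → PPSystem.{u} Γ → Prop) (Y : PPSystem.{u} Γ) : Prop :=
  ∃ (Z : ι → PPSystem.{u} Γ) (π : ∀ i, Y.carrier → (Z i).carrier),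
    (∀ i, C i (Z i)) ∧ (∀ i, Y.IsFactorMap (Z i) (π i)) ∧
    ∀ s : Set Y.carrier, MeasurableSet s →
      ∃ t : Set Y.carrier, MeasurableSet[⨆ i, (Z i).mspace.comap (π i)] t ∧ s =ᵐ[Y.μ] t

/-- The maximal factor of `X` in the class `C`, as a sigma-subalgebra: it is generated by all
factor maps from `X` to members of `C`. A set of this sigma-algebra involves only countably many
of these factor maps, so if `C` is closed under (countable) joinings, as the classes
below are, then up to null sets this is the largest sigma-subalgebra of `X` that is
generated by a factor map to a member of `C`. -/
def maxFactor (C : PPSystem.{u} Γ → Prop) (X : PPSystem.{u} Γ) : MeasurableSpace X.carrier :=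
  ⨆ (Y : PPSystem.{u} Γ) (_ : C Y) (π : X.carrier → Y.carrier) (_ : X.IsFactorMap Y π),
    Y.mspace.comap π

end PPSystem

/-- The sigma-subalgebras `S₁` and `S₂` are relatively independent under `μ` over their common
sigma-subalgebra `Ξ`. -/
def RelIndepOver {Ω : Type*} [MeasurableSpace Ω] (μ : Measure Ω)
    (S₁ S₂ Ξ : MeasurableSpace Ω) : Prop :=
  Ξ ≤ S₁ ∧ Ξ ≤ S₂ ∧
  ∀ f₁ f₂ : Ω → ℝ, Measurable[S₁] f₁ → Measurable[S₂] f₂ → MemLp f₁ ∞ μ → MemLp f₂ ∞ μ →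
    ∫ x, f₁ x * f₂ x ∂μ = ∫ x, (μ[f₁ | Ξ]) x * (μ[f₂ | Ξ]) x ∂μ

namespace PPSystem

section General

variable {Γ : Type v} [AddGroup Γ]

/-- `X` is `C`-sated: for every extension `π : Y → X`, the factor generated by `π` and the
maximal `C`-factor of `Y` are relatively independent over the lift to `Y` of the
maximal `C`-factor of `X`. -/
def IsSated (C : PPSystem.{u} Γ → Prop) (X : PPSystem.{u} Γ) : Prop :=
  ∀ (Y : PPSystem.{u} Γ) (π : Y.carrier → X.carrier), Y.IsFactorMap X π →
    RelIndepOver Y.μ (X.mspace.comap π) (Y.maxFactor C) ((X.maxFactor C).comap π)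

/-- The `Λ`-partially invariant factor: the sigma-algebra of all measurable sets that are
invariant, up to null sets, under the subaction of `Λ`. -/
def invariantFactor (X : PPSystem.{u} Γ) (Λ : AddSubgroup Γ) : MeasurableSpace X.carrier where
  MeasurableSet' s := MeasurableSet s ∧ ∀ g ∈ Λ, X.T g ⁻¹' s =ᵐ[X.μ] s
  measurableSet_empty := ⟨MeasurableSet.empty, fun _ _ => by simp⟩
  measurableSet_compl := fun s hs => ⟨hs.1.compl, fun g hg => by
    rw [Set.preimage_compl]; exact (hs.2 g hg).compl⟩
  measurableSet_iUnion := fun s hs => ⟨MeasurableSet.iUnion fun i => (hs i).1, fun g hg => by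
    rw [Set.preimage_iUnion]; exact Filter.EventuallyEq.countable_iUnion fun i => (hs i).2 g hg⟩

end General

section Zd

variable {d : ℕ}

/-- The subgroup of `ℤ^d` generated by the differences `𝐞_i - 𝐞_l` for `i, l ∈ a`. If `i₁ ∈ a`,
this is the sum of the subgroups `ℤ (𝐞_{i₁} - 𝐞_l)` for `l ∈ a`. -/
def diffSubgroup (a : Finset (Fin d)) : AddSubgroup (Fin d → ℤ) :=
  AddSubgroup.closure
    {v | ∃ i ∈ a, ∃ l ∈ a, v = Pi.single (M := fun _ => ℤ) i 1 - Pi.single l 1}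

/-- The class `C_e`: the join over `j ∈ [d] \ e` of the classes of systems that are
partially invariant under `diffSubgroup (e ∪ {j})`. -/
def ClassC (e : Finset (Fin d)) : PPSystem.{u} (Fin d → ℤ) → Prop :=
  ClassJoin fun j : {j : Fin d // j ∉ e} => ClassZ0 (diffSubgroup (insert j.1 e))

/-- `ν` is the limit joining: for all measurable `A_1, …, A_d`, the averages over `1 ≤ n ≤ N` of
`μ (T^{-n𝐞_1} A_1 ∩ ⋯ ∩ T^{-n𝐞_d} A_d)` converge to `ν (A_1 × ⋯ × A_d)`. -/
structure IsFurstenbergSelfJoining (X : PPSystem.{u} (Fin d → ℤ))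
    (ν : Measure (Fin d → X.carrier)) : Prop where
  prob : IsProbabilityMeasure ν
  tendsto : ∀ A : Fin d → Set X.carrier, (∀ i, MeasurableSet (A i)) →
    Tendsto (fun N : ℕ => (N : ℝ)⁻¹ * ∑ n ∈ Finset.Icc 1 N,
        X.μ.real (⋂ i, X.T (Pi.single i (n : ℤ)) ⁻¹' A i))
      atTop (𝓝 (ν.real (Set.univ.pi A)))

theorem IsFurstenbergSelfJoining.unique {X : PPSystem.{u} (Fin d → ℤ)}
    {ν ν' : Measure (Fin d → X.carrier)} (h : X.IsFurstenbergSelfJoining ν)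
    (h' : X.IsFurstenbergSelfJoining ν') : ν = ν' := by
  have := h.prob
  have := h'.prob
  refine ext_of_generate_finite _ generateFrom_pi.symm isPiSystem_pi ?_ (by simp)
  rintro _ ⟨A, hA, rfl⟩
  have hA' : ∀ i, MeasurableSet (A i) := fun i => hA i (Set.mem_univ i)
  have := tendsto_nhds_unique (h.tendsto A hA') (h'.tendsto A hA')
  exact (measureReal_eq_measureReal_iff).1 this

open Classical in
/-- The Furstenberg self-joining `μ^F` of `X`: the measure with the above limit property. -/
noncomputable def furstenbergSelfJoining (X : PPSystem.{u} (Fin d → ℤ)) :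
    Measure (Fin d → X.carrier) :=
  if h : ∃ ν, X.IsFurstenbergSelfJoining ν then h.choose else 0

theorem IsFurstenbergSelfJoining.furstenbergSelfJoining_eq {X : PPSystem.{u} (Fin d → ℤ)}
    {ν : Measure (Fin d → X.carrier)} (h : X.IsFurstenbergSelfJoining ν) :
    X.furstenbergSelfJoining = ν := by
  have hex : ∃ ν, X.IsFurstenbergSelfJoining ν := ⟨ν, h⟩
  rw [furstenbergSelfJoining, dif_pos hex]
  exact hex.choose_spec.unique h

/-- The completion of a sigma-subalgebra `m` inside the sigma-algebra of `Ω`: all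
measurable sets that agree with a member of `m` up to a `μ`-null set. -/
def completionIn {Ω : Type*} [m₀ : MeasurableSpace Ω] (μ : Measure Ω) (m : MeasurableSpace Ω) :
    MeasurableSpace Ω :=
  eventuallyMeasurableSpace m (ae μ) ⊓ m₀

/-- The oblique copy `Φ^F_e` of the factor `Φ_e`, the partially invariant factor of
`diffSubgroup e`: the completion under `μ^F` of the sigma-algebra `π_i⁻¹ Φ_e`, which up to null
sets is the same for all `i ∈ e`. -/
noncomputable def obliqueCopy (X : PPSystem.{u} (Fin d → ℤ)) (e : Finset (Fin d)) :
    MeasurableSpace (Fin d → X.carrier) :=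
  completionIn X.furstenbergSelfJoining
    (⨆ i ∈ e, (X.invariantFactor (diffSubgroup e)).comap fun x => x i)

/-- The sets `π_i⁻¹ A` and `π_j⁻¹ A` agree up to a null set, for `A ∈ Φ_e` and `i, j ∈ e`. -/
theorem IsFurstenbergSelfJoining.preimage_ae_eq {X : PPSystem.{u} (Fin d → ℤ)}
    {ν : Measure (Fin d → X.carrier)} (h : X.IsFurstenbergSelfJoining ν)
    {e : Finset (Fin d)} {i j : Fin d} (hi : i ∈ e) (hj : j ∈ e) {A : Set X.carrier}
    (hA : MeasurableSet[X.invariantFactor (diffSubgroup e)] A) :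
    (fun x : Fin d → X.carrier => x i) ⁻¹' A =ᵐ[ν] (fun x => x j) ⁻¹' A := by
  have := h.prob
  have key : ∀ i ∈ e, ∀ j ∈ e, ν {x | x i ∈ A ∧ x j ∉ A} = 0 := by
    intro i hi j hj
    by_cases hij : i = j
    · subst hij
      simp
    let B : Fin d → Set X.carrier := fun k => if k = i then A else if k = j then Aᶜ else Set.univ
    have hB : ∀ k, MeasurableSet (B k) := by
      intro k
      simp only [B]
      split_ifs
      exacts [hA.1, hA.1.compl, MeasurableSet.univ]
    have hBi : B i = A := by simp [B]
    have hBj : B j = Aᶜ := by simp [B, Ne.symm hij]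
    have hlim := h.tendsto B hB
    have hzero : ∀ n : ℕ, X.μ.real (⋂ k, X.T (Pi.single k (n : ℤ)) ⁻¹' B k) = 0 := by
      intro n
      have hmem : Pi.single (M := fun _ => ℤ) i (n : ℤ) - Pi.single j (n : ℤ) ∈ diffSubgroup e := by
        have h1 : Pi.single (M := fun _ => ℤ) i 1 - Pi.single j 1 ∈ diffSubgroup e :=
          AddSubgroup.subset_closure ⟨i, hi, j, hj, rfl⟩
        have h2 := (diffSubgroup e).nsmul_mem h1 n
        convert h2 using 1
        ext k
        simp [Pi.single_apply, mul_sub]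
      have h3 := (X.measurePreserving (Pi.single j (n : ℤ))).quasiMeasurePreserving.preimage_ae_eq
        (hA.2 _ hmem)
      rw [← Set.preimage_comp, ← X.T_add, sub_add_cancel] at h3
      have h4 : X.μ (X.T (Pi.single i (n : ℤ)) ⁻¹' A \ X.T (Pi.single j (n : ℤ)) ⁻¹' A) = 0 :=
        ae_le_set.1 h3.le
      have h5 : X.μ (⋂ k, X.T (Pi.single k (n : ℤ)) ⁻¹' B k) = 0 := by
        refine measure_mono_null (fun x hx => ?_) h4
        rw [Set.mem_iInter] at hx
        have hxi := hx i
        have hxj := hx j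
        rw [hBi] at hxi
        rw [hBj] at hxj
        exact ⟨hxi, hxj⟩
      simp [Measure.real, h5]
    simp only [hzero, Finset.sum_const_zero, mul_zero] at hlim
    have h6 := tendsto_nhds_unique hlim tendsto_const_nhds
    have h7 : ν (Set.univ.pi B) = 0 := (measureReal_eq_zero_iff).1 h6
    refine measure_mono_null (t := Set.univ.pi B) ?_ h7
    intro x hx k _
    by_cases hki : k = i
    · subst hki
      simpa [hBi] using hx.1
    by_cases hkj : k = j
    · subst hkj
      simpa [hBj] using hx.2
    simp [B, hki, hkj]
  exact (ae_le_set.2 (key i hi j hj)).antisymm (ae_le_set.2 (key j hj i hi))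

/-- The oblique factor `Φ^F_I` of a family `I` of subsets of `[d]`. -/
noncomputable def obliqueFactor (X : PPSystem.{u} (Fin d → ℤ)) (I : Set (Finset (Fin d))) :
    MeasurableSpace (Fin d → X.carrier) :=
  ⨆ e ∈ I, X.obliqueCopy e

/-- `I` is an up-set in the family of all subsets of `[d]` with at least two elements. -/
def IsUpSetGeTwo (I : Set (Finset (Fin d))) : Prop :=
  (∀ e ∈ I, 2 ≤ e.card) ∧ ∀ e ∈ I, ∀ e' : Finset (Fin d), e ⊆ e' → e' ∈ I

end Zd

end PPSystem

/-!
The key step treats one oblique copy `Φ^F_e`, for a set `e` that contains no member of the up-set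
`I`. Each oblique copy making up `Φ^F_I` can then be read off a coordinate outside `e`
(`obliqueFactor_le_completionIn`). Let `i ∈ e`. The Furstenberg self-joining `μ^F` is invariant
under the diagonal action and under `T^{𝐞_1} × ⋯ × T^{𝐞_d}` (`measurePreserving_shift`), so `ℤ^d`
acts on it in such a way that the vectors `𝐞_k`, `k ∈ e`, act by `T^{𝐞_1} × ⋯ × T^{𝐞_d}` and the
others act diagonally. On a coordinate `j ∉ e` this action is `T` twisted by an endomorphism of
`ℤ^d` that kills `diffSubgroup (e ∪ {j})`, hence a member of the class `C_e`. On the coordinate `i`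
it agrees with `T` modulo `diffSubgroup e`, so it has the same factor `Φ_e` as `X`. The relatively
independent product of this system and `X` over `Φ_e` is thus an extension of `X` whose maximal
`C_e`-factor contains all coordinates of `μ^F` outside `e` (`comap_fst_le_maxFactor`). Satedness of
`X` for this extension says that an event of `Φ_e` in the coordinate `i` may be replaced, in
integrals against functions of the coordinates outside `e`, by its conditional probability given the
maximal `C_e`-factor of `X` (`setIntegral_condExp_maxFactor`). Up to null sets that factor is
contained in the join of the `Φ_{e ∪ {j}}`, `j ∉ e` (`maxFactor_classC_le`). Hence `Φ^F_e` and
`Φ^F_I` are relatively independent over any oblique factor inside `Φ^F_I` that contains all the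
`Φ^F_{e ∪ {j}}` (`condExp_obliqueCopy_indicator`).

The general case follows by induction on the size of `I \ I'`. For a maximal element `e` of `I \ I'`
all proper supersets of `e` lie in `I ∩ I'`, and `I' ∪ {e}` is an up-set. By the inductive
hypothesis, conditioning a function of `Φ^F_{I'}` on `Φ^F_I` amounts to conditioning it on `Φ^F_{I ∩
I'} ∨ Φ^F_e`, and by the key step `Φ^F_e` can be dropped (`condExp_sup_ae_eq_of_forall_indicator`).
-/

/-! ### Conditional expectation and relative independence -/

namespace MeasureTheory

section CondExp

variable {Ω Ω' : Type*}

/-- Two maps that pull back every set of `m` to the same set, up to null sets, pull back every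
`m`-measurable real function to the same function, up to null sets. -/
theorem ae_eq_comp_of_preimage_ae_eq {m₀ : MeasurableSpace Ω} {m : MeasurableSpace Ω'}
    {μ : Measure Ω} {p q : Ω → Ω'}
    (h : ∀ A, MeasurableSet[m] A → p ⁻¹' A =ᵐ[μ] q ⁻¹' A) {f : Ω' → ℝ} (hf : Measurable[m] f) :
    f ∘ p =ᵐ[μ] f ∘ q :=
  EventuallyEq.of_forall_separating_preimage MeasurableSet fun _ hU => h _ (hf hU)

/-- Conditional expectation commutes with pulling back along a measure-preserving map. -/
theorem condExp_comp_measurePreserving {m₀ : MeasurableSpace Ω} {m m₀' : MeasurableSpace Ω'}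
    {μ : Measure Ω} {μ' : Measure Ω'} [IsFiniteMeasure μ] [IsFiniteMeasure μ'] {p : Ω → Ω'}
    (hp : MeasurePreserving p μ μ') (hm : m ≤ m₀') {f : Ω' → ℝ} (hf : Integrable f μ') :
    μ[f ∘ p | m.comap p] =ᵐ[μ] μ'[f | m] ∘ p := by
  have hle : m.comap p ≤ m₀ := (MeasurableSpace.comap_mono hm).trans hp.measurable.comap_le
  refine (ae_eq_condExp_of_forall_setIntegral_eq hle (hp.integrable_comp_of_integrable hf)
    (fun s _ _ => (hp.integrable_comp_of_integrable integrable_condExp).integrableOn) ?_ ?_).symm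
  · rintro _ ⟨t, ht, rfl⟩ _
    have key : ∀ g : Ω' → ℝ, Integrable g μ' →
        ∫ x in p ⁻¹' t, (g ∘ p) x ∂μ = ∫ y in t, g y ∂μ' := by
      intro g hg
      rw [← hp.map_eq] at hg ⊢
      exact (setIntegral_map (hm _ ht) hg.1 hp.measurable.aemeasurable).symm
    rw [key _ integrable_condExp, key _ hf, setIntegral_condExp hm hf ht]
  · exact (stronglyMeasurable_condExp.comp_measurable
      (comap_measurable p : Measurable[m.comap p, m] p)).aestronglyMeasurable

variable {m H E K m₀ : MeasurableSpace Ω} {μ : Measure Ω}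

/-- A factor that is measurable for the conditioning sigma-algebra may be integrated against the
conditional expectation. -/
theorem integral_condExp_mul [IsFiniteMeasure μ] (hm : m ≤ m₀) {f g : Ω → ℝ}
    (hf : Integrable f μ) (hg : AEStronglyMeasurable[m] g μ) (hfg : Integrable (f * g) μ) :
    ∫ x, (μ[f | m]) x * g x ∂μ = ∫ x, f x * g x ∂μ := by
  exact (integral_congr_ae (condExp_mul_of_aestronglyMeasurable_right hg hfg hf)).symm.trans
    (integral_condExp hm)

theorem MemLp.integrable_of_top [IsFiniteMeasure μ] {f : Ω → ℝ} (hf : MemLp f ∞ μ) :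
    Integrable f μ :=
  hf.integrable le_top

theorem MemLp.mul_top {f g : Ω → ℝ} (hf : MemLp f ∞ μ) (hg : MemLp g ∞ μ) :
    MemLp (f * g) ∞ μ :=
  MemLp.mul hg hf

theorem memLp_top_indicator [IsFiniteMeasure μ] {s : Set Ω} (hs : MeasurableSet s) :
    MemLp (s.indicator fun _ => (1 : ℝ)) ∞ μ :=
  (memLp_const 1).indicator hs

theorem integral_inter_eq_mul {C A : Set Ω} (hC : MeasurableSet C) (hA : MeasurableSet A)
    (f : Ω → ℝ) :
    ∫ x in C ∩ A, f x ∂μ =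
      ∫ x, A.indicator (fun _ => (1 : ℝ)) x * (C.indicator f x) ∂μ := by
  rw [← integral_indicator (hC.inter hA)]
  congr with x
  by_cases h : x ∈ C <;> by_cases h' : x ∈ A <;> simp [h, h']

/-- Suppose `H ≤ K` and every event of `E` is conditionally independent of `K` given `H`. Then a
`K`-measurable function is conditionally independent of `H ⊔ E` given `H`. -/
theorem condExp_sup_ae_eq_of_forall_indicator [IsFiniteMeasure μ] (hHK : H ≤ K)
    (hK : K ≤ m₀) (hE : E ≤ m₀)
    (h : ∀ A, MeasurableSet[E] A →
      μ[A.indicator fun _ => (1 : ℝ) | K] =ᵐ[μ] μ[A.indicator fun _ => (1 : ℝ) | H])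
    {f : Ω → ℝ} (hfK : AEStronglyMeasurable[K] f μ) (hf : MemLp f ∞ μ) :
    μ[f | H ⊔ E] =ᵐ[μ] μ[f | H] := by
  have hH : H ≤ m₀ := hHK.trans hK
  have hle : H ⊔ E ≤ m₀ := sup_le hH hE
  have hfi := hf.integrable_of_top
  have hcond : MemLp (μ[f | H]) ∞ μ := hf.condExp le_top
  -- The two functions have the same integral on each event `C ∩ A`, where `C ∈ H` and `A ∈ E`.
  have hinter : ∀ C A, MeasurableSet[H] C → MeasurableSet[E] A →
      ∫ x in C ∩ A, (μ[f | H]) x ∂μ = ∫ x in C ∩ A, f x ∂μ := by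
    intro C A hC hA
    have hA1 : MemLp (A.indicator fun _ => (1 : ℝ)) ∞ μ := memLp_top_indicator (hE _ hA)
    have step : ∀ g : Ω → ℝ, AEStronglyMeasurable[K] g μ → MemLp g ∞ μ →
        ∫ x in C ∩ A, g x ∂μ =
          ∫ x in C, (μ[A.indicator fun _ => (1 : ℝ) | H]) x * g x ∂μ := by
      intro g hgK hg
      have hCg : MemLp (C.indicator g) ∞ μ := hg.indicator (hH _ hC)
      have hCgK : AEStronglyMeasurable[K] (C.indicator g) μ := by
        obtain ⟨g', hg', hgg'⟩ := hgK
        refine ⟨C.indicator g', hg'.indicator (hHK _ hC), ?_⟩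
        filter_upwards [hgg'] with x hx
        by_cases hxC : x ∈ C <;> simp [hxC, hx]
      rw [integral_inter_eq_mul (hH _ hC) (hE _ hA),
        ← integral_condExp_mul hK hA1.integrable_of_top hCgK
          (hA1.mul_top hCg).integrable_of_top, ← integral_indicator (hH _ hC)]
      refine integral_congr_ae ?_
      filter_upwards [h A hA] with x hx
      rw [hx]
      by_cases hxC : x ∈ C <;> simp [hxC]
    rw [step _ (stronglyMeasurable_condExp.mono hHK).aestronglyMeasurable hcond,
      step _ hfK hf]
    have hcA : MemLp (μ[A.indicator fun _ => (1 : ℝ) | H]) ∞ μ := hA1.condExp le_top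
    have hG : AEStronglyMeasurable[H]
        (C.indicator (μ[A.indicator fun _ => (1 : ℝ) | H])) μ :=
      (stronglyMeasurable_condExp.indicator hC).aestronglyMeasurable
    have := integral_condExp_mul hH hfi hG
      (hf.mul_top (hcA.indicator (hH _ hC))).integrable_of_top
    rw [← integral_indicator (hH _ hC), ← integral_indicator (hH _ hC)]
    convert this using 2 <;> ext x <;> by_cases hxC : x ∈ C <;> simp [hxC, mul_comm]
  let S : Set (Set Ω) := {D | ∃ C A, MeasurableSet[H] C ∧ MeasurableSet[E] A ∧ D = C ∩ A}
  have hS : IsPiSystem S := by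
    rintro _ ⟨C, A, hC, hA, rfl⟩ _ ⟨C', A', hC', hA', rfl⟩ _
    exact ⟨C ∩ C', A ∩ A', hC.inter hC', hA.inter hA', Set.inter_inter_inter_comm ..⟩
  have hgen : H ⊔ E = MeasurableSpace.generateFrom S := by
    refine le_antisymm (sup_le ?_ ?_) (MeasurableSpace.generateFrom_le ?_)
    · exact fun C hC => MeasurableSpace.measurableSet_generateFrom
        ⟨C, Set.univ, hC, MeasurableSet.univ, by simp⟩
    · exact fun A hA => MeasurableSpace.measurableSet_generateFrom
        ⟨Set.univ, A, MeasurableSet.univ, hA, by simp⟩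
    · rintro _ ⟨C, A, hC, hA, rfl⟩
      exact MeasurableSet.inter ((le_sup_left : H ≤ H ⊔ E) _ hC)
        ((le_sup_right : E ≤ H ⊔ E) _ hA)
  refine (ae_eq_condExp_of_forall_setIntegral_eq hle hfi
    (fun s _ _ => integrable_condExp.integrableOn) (fun s hs _ => ?_)
    (stronglyMeasurable_condExp.mono (le_sup_left : H ≤ H ⊔ E)).aestronglyMeasurable).symm
  induction s, hs using MeasurableSpace.induction_on_inter hgen hS with
  | empty => simp
  | basic D hD =>
    obtain ⟨C, A, hC, hA, rfl⟩ := hD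
    exact hinter C A hC hA
  | compl D hD ih =>
    rw [setIntegral_compl (hle _ hD) integrable_condExp, setIntegral_compl (hle _ hD) hfi,
      ih (measure_lt_top _ _), integral_condExp hH]
  | iUnion D hdisj hD ih =>
    rw [integral_iUnion (fun i => hle _ (hD i)) hdisj integrable_condExp.integrableOn,
      integral_iUnion (fun i => hle _ (hD i)) hdisj hfi.integrableOn]
    exact tsum_congr fun i => ih i (measure_lt_top _ _)

end CondExp

end MeasureTheory

/-- Relative independence follows once conditioning a function of `S₂` on `S₁` amounts to
conditioning it on `Ξ`. -/
theorem RelIndepOver.of_condExp_ae_eq {Ω : Type*} {S₁ S₂ Ξ m₀ : MeasurableSpace Ω} {μ : Measure Ω}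
    [IsFiniteMeasure μ] (h₁ : Ξ ≤ S₁) (h₂ : Ξ ≤ S₂) (hS₁ : S₁ ≤ m₀)
    (h : ∀ f : Ω → ℝ, AEStronglyMeasurable[S₂] f μ → MemLp f ∞ μ → μ[f | S₁] =ᵐ[μ] μ[f | Ξ]) :
    RelIndepOver μ S₁ S₂ Ξ := by
  refine ⟨h₁, h₂, fun f₁ f₂ hm₁ hm₂ hf₁ hf₂ => ?_⟩
  have hΞ := h₁.trans hS₁
  have hc : MemLp (μ[f₂ | Ξ]) ∞ μ := hf₂.condExp le_top
  calc ∫ x, f₁ x * f₂ x ∂μ = ∫ x, f₂ x * f₁ x ∂μ := by simp only [mul_comm]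
    _ = ∫ x, (μ[f₂ | S₁]) x * f₁ x ∂μ :=
      (integral_condExp_mul hS₁ hf₂.integrable_of_top hm₁.stronglyMeasurable.aestronglyMeasurable
        (hf₂.mul_top hf₁).integrable_of_top).symm
    _ = ∫ x, f₁ x * (μ[f₂ | Ξ]) x ∂μ := by
      refine integral_congr_ae ?_
      filter_upwards [h f₂ hm₂.stronglyMeasurable.aestronglyMeasurable hf₂] with x hx
      rw [hx, mul_comm]
    _ = ∫ x, (μ[f₁ | Ξ]) x * (μ[f₂ | Ξ]) x ∂μ :=
      (integral_condExp_mul hΞ hf₁.integrable_of_top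
        stronglyMeasurable_condExp.aestronglyMeasurable (hf₁.mul_top hc).integrable_of_top).symm

/-! ### Completions of sigma-subalgebras -/

namespace PPSystem

section Completion

variable {Ω Ω' : Type*} {m m' m₀ : MeasurableSpace Ω} {μ : Measure Ω}

theorem completionIn_le : completionIn μ m ≤ m₀ :=
  inf_le_right

theorem le_completionIn (hm : m ≤ m₀) : m ≤ completionIn μ m :=
  le_inf le_eventuallyMeasurableSpace hm

theorem completionIn_le_completionIn (h : m ≤ completionIn μ m') :
    completionIn μ m ≤ completionIn μ m' := by
  rintro s ⟨⟨t, ht, hst⟩, hs⟩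
  obtain ⟨⟨r, hr, htr⟩, -⟩ := h _ ht
  exact ⟨⟨r, hr, hst.trans htr⟩, hs⟩

theorem comap_completionIn_le {n m₀' : MeasurableSpace Ω'} {μ' : Measure Ω'} {p : Ω → Ω'}
    (hp : MeasurePreserving p μ μ') :
    (completionIn μ' n).comap p ≤ completionIn μ (n.comap p) := by
  rintro _ ⟨s, ⟨⟨t, ht, hst⟩, hs⟩, rfl⟩
  exact ⟨⟨p ⁻¹' t, ⟨t, ht, rfl⟩, hp.quasiMeasurePreserving.preimage_ae_eq hst⟩,
    hp.measurable hs⟩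

/-- Enlarging a sigma-algebra by null sets does not change conditional expectations. -/
theorem condExp_ae_eq_of_le_completionIn [IsFiniteMeasure μ] (h : m ≤ m')
    (h' : m' ≤ completionIn μ m) {f : Ω → ℝ} (hf : Integrable f μ) :
    μ[f | m'] =ᵐ[μ] μ[f | m] := by
  have hm' : m' ≤ m₀ := h'.trans completionIn_le
  refine (ae_eq_condExp_of_forall_setIntegral_eq hm' hf
    (fun s _ _ => integrable_condExp.integrableOn) (fun s hs _ => ?_)
    (stronglyMeasurable_condExp.mono h).aestronglyMeasurable).symm
  obtain ⟨⟨t, ht, hst⟩, -⟩ := h' _ hs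
  rw [setIntegral_congr_set hst, setIntegral_congr_set hst,
    setIntegral_condExp (h.trans hm') hf ht]

theorem aestronglyMeasurable_of_completionIn [IsFiniteMeasure μ] (hm : m ≤ m₀) {f : Ω → ℝ}
    (hf : StronglyMeasurable[completionIn μ m] f) (hfi : Integrable f μ) :
    AEStronglyMeasurable[m] f μ := by
  have h := condExp_ae_eq_of_le_completionIn (le_completionIn (μ := μ) hm) le_rfl hfi
  rw [condExp_of_stronglyMeasurable completionIn_le hf hfi] at h
  exact ⟨_, stronglyMeasurable_condExp, h⟩

end Completion

end PPSystem

/-! ### Invariance of the Furstenberg self-joining -/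

namespace PPSystem

section Shift

theorem tendsto_average_shift_one_iff {b : ℤ → ℝ} (hb : ∀ n, |b n| ≤ 1) {L : ℝ} :
    Tendsto (fun N : ℕ => (N : ℝ)⁻¹ * ∑ n ∈ Finset.Icc 1 N, b (n + 1)) atTop (𝓝 L) ↔
      Tendsto (fun N : ℕ => (N : ℝ)⁻¹ * ∑ n ∈ Finset.Icc 1 N, b n) atTop (𝓝 L) := by
  have htel : ∀ N : ℕ, ∑ n ∈ Finset.Icc 1 N, b (n + 1) =
      ∑ n ∈ Finset.Icc 1 N, b n + (b (N + 1) - b 1) := by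
    intro N
    induction N with
    | zero => simp
    | succ N ih =>
      rw [Finset.sum_Icc_succ_top (by omega), Finset.sum_Icc_succ_top (by omega), ih]
      push_cast
      ring
  have hdiff : Tendsto (fun N : ℕ => (N : ℝ)⁻¹ * (b (N + 1) - b 1)) atTop (𝓝 0) := by
    refine squeeze_zero_norm (a := fun N : ℕ => (N : ℝ)⁻¹ * 2) (fun N => ?_) ?_
    · rw [norm_mul, norm_inv, RCLike.norm_natCast, Real.norm_eq_abs]
      gcongr
      linarith [abs_sub (b (N + 1)) (b 1), hb (N + 1), hb 1]
    · simpa using (tendsto_inv_atTop_nhds_zero_nat (𝕜 := ℝ)).mul_const 2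
  simp only [htel, mul_add]
  refine ⟨fun h => ?_, fun h => ?_⟩
  · simpa using h.sub hdiff
  · simpa using h.add hdiff

/-- Averages of a bounded two-sided sequence are asymptotically invariant under translation. -/
theorem tendsto_average_shift {b : ℤ → ℝ} (hb : ∀ n, |b n| ≤ 1) {L : ℝ} (s : ℤ)
    (h : Tendsto (fun N : ℕ => (N : ℝ)⁻¹ * ∑ n ∈ Finset.Icc 1 N, b n) atTop (𝓝 L)) :
    Tendsto (fun N : ℕ => (N : ℝ)⁻¹ * ∑ n ∈ Finset.Icc 1 N, b (n + s)) atTop (𝓝 L) := by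
  have step : ∀ s : ℤ,
      Tendsto (fun N : ℕ => (N : ℝ)⁻¹ * ∑ n ∈ Finset.Icc 1 N, b (n + (s + 1))) atTop (𝓝 L) ↔
      Tendsto (fun N : ℕ => (N : ℝ)⁻¹ * ∑ n ∈ Finset.Icc 1 N, b (n + s)) atTop (𝓝 L) := by
    intro s
    have := tendsto_average_shift_one_iff (b := fun n => b (n + s)) (fun n => hb _) (L := L)
    simpa only [add_assoc, add_comm (1 : ℤ)] using this
  induction s using Int.induction_on with
  | zero => simpa using h
  | succ i ih => exact (step i).2 ih
  | pred i ih => exact (step _).1 (by simpa using ih)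

end Shift

variable {d : ℕ}

theorem T_neg_comp {Γ : Type v} [AddGroup Γ] (X : PPSystem.{u} Γ) (g : Γ) (x : X.carrier) :
    X.T (-g) (X.T g x) = x := by
  rw [← Function.comp_apply (f := X.T (-g)), ← X.T_add, neg_add_cancel, X.T_zero, id]

namespace IsFurstenbergSelfJoining

variable {X : PPSystem.{u} (Fin d → ℤ)} {ν : Measure (Fin d → X.carrier)}

/-- The coordinate projections of the Furstenberg self-joining have the law `μ`. -/
theorem measurePreserving_eval (h : X.IsFurstenbergSelfJoining ν) (i : Fin d) :
    MeasurePreserving (fun x : Fin d → X.carrier => x i) ν X.μ := by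
  have := h.prob
  refine ⟨measurable_pi_apply i, Measure.ext fun A hA => ?_⟩
  rw [Measure.map_apply (measurable_pi_apply i) hA]
  let B : Fin d → Set X.carrier := fun k => if k = i then A else Set.univ
  have hB : ∀ k, MeasurableSet (B k) := fun k => by
    simp only [B]; split_ifs; exacts [hA, MeasurableSet.univ]
  have hpi : Set.univ.pi B = (fun x : Fin d → X.carrier => x i) ⁻¹' A := by
    ext x
    simp only [Set.mem_univ_pi, Set.mem_preimage, B]
    refine ⟨fun hx => by simpa using hx i, fun hx k => ?_⟩
    split_ifs with hk
    · exact hk ▸ hx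
    · trivial
  have hinter : ∀ n : ℕ, X.μ.real (⋂ k, X.T (Pi.single k (n : ℤ)) ⁻¹' B k) = X.μ.real A := by
    intro n
    have : ⋂ k, X.T (Pi.single k (n : ℤ)) ⁻¹' B k = X.T (Pi.single i (n : ℤ)) ⁻¹' A := by
      ext x
      simp only [Set.mem_iInter, Set.mem_preimage, B]
      refine ⟨fun hx => by simpa using hx i, fun hx k => ?_⟩
      split_ifs with hk
      · exact hk ▸ hx
      · trivial
    rw [this, measureReal_def, (X.measurePreserving _).measure_preimage hA.nullMeasurableSet,
      measureReal_def]
  have hlim := h.tendsto B hB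
  simp only [hinter, hpi, Finset.sum_const, Nat.card_Icc, Nat.add_sub_cancel, nsmul_eq_mul] at hlim
  have hconst : Tendsto (fun N : ℕ => (N : ℝ)⁻¹ * (N * X.μ.real A)) atTop (𝓝 (X.μ.real A)) := by
    refine tendsto_const_nhds.congr' ?_
    filter_upwards [eventually_ne_atTop 0] with N hN
    rw [inv_mul_cancel_left₀ (Nat.cast_ne_zero.2 hN)]
  exact (measureReal_eq_measureReal_iff).1 (tendsto_nhds_unique hlim hconst)

/-- The Furstenberg self-joining is invariant under the diagonal action of `ℤ^d` and under the
powers of `T^{𝐞_1} × ⋯ × T^{𝐞_d}`. -/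
theorem measurePreserving_shift (h : X.IsFurstenbergSelfJoining ν) (γ : Fin d → ℤ) (s : ℤ) :
    MeasurePreserving (fun (x : Fin d → X.carrier) l => X.T (γ + Pi.single l s) (x l)) ν ν := by
  have := h.prob
  have hmeas : Measurable fun (x : Fin d → X.carrier) l => X.T (γ + Pi.single l s) (x l) :=
    measurable_pi_lambda _ fun l =>
      (X.measurePreserving _).measurable.comp (measurable_pi_apply l)
  refine ⟨hmeas, IsFurstenbergSelfJoining.unique
    ⟨Measure.isProbabilityMeasure_map hmeas.aemeasurable, fun A hA => ?_⟩ h⟩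
  let b : ℤ → ℝ := fun n => X.μ.real (⋂ i, X.T (Pi.single i n) ⁻¹' A i)
  have hb : ∀ n, |b n| ≤ 1 := fun n => by
    rw [abs_of_nonneg measureReal_nonneg]; exact measureReal_le_one
  -- A shift by `γ + s𝐞_i` on the `i`-th coordinate translates the sequence of averages by `s`.
  have hkey : ∀ (γ : Fin d → ℤ) (m : ℤ),
      X.μ.real (⋂ i, X.T (γ + Pi.single i m) ⁻¹' A i) =
        X.μ.real (⋂ i, X.T (Pi.single i m) ⁻¹' A i) := by
    intro γ m
    have : ⋂ i, X.T (γ + Pi.single i m) ⁻¹' A i =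
        X.T γ ⁻¹' ⋂ i, X.T (Pi.single i m) ⁻¹' A i := by
      rw [Set.preimage_iInter]
      refine Set.iInter_congr fun i => ?_
      rw [← Set.preimage_comp, ← X.T_add, add_comm]
    rw [this, measureReal_def, (X.measurePreserving _).measure_preimage, measureReal_def]
    exact (MeasurableSet.iInter fun i =>
      (X.measurePreserving _).measurable (hA i)).nullMeasurableSet
  have hpre : (fun (x : Fin d → X.carrier) l => X.T (γ + Pi.single l s) (x l)) ⁻¹' Set.univ.pi A =
      Set.univ.pi fun l => X.T (γ + Pi.single l s) ⁻¹' A l := by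
    ext x; simp
  have hlim := h.tendsto _ fun l => (X.measurePreserving (γ + Pi.single l s)).measurable (hA l)
  rw [← hpre] at hlim
  have hterm : ∀ n : ℕ, X.μ.real (⋂ i, X.T (Pi.single i (n : ℤ)) ⁻¹'
      (X.T (γ + Pi.single i s) ⁻¹' A i)) = b (n + s) := by
    intro n
    refine Eq.trans ?_ (hkey γ (n + s))
    congr 1
    refine Set.iInter_congr fun i => ?_
    rw [← Set.preimage_comp, ← X.T_add, add_assoc, ← Pi.single_add, add_comm s]
  simp only [hterm] at hlim
  rw [map_measureReal_apply hmeas (MeasurableSet.univ_pi hA),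
    tendsto_nhds_unique hlim (tendsto_average_shift hb s (h.tendsto A hA))]
  exact h.tendsto A hA

end IsFurstenbergSelfJoining

/-- The endomorphism of `ℤ^d` that replaces each basis vector `𝐞_k`, `k ∈ e`, by `𝐞_l` and fixes
the other basis vectors. -/
def collapse (e : Finset (Fin d)) (l : Fin d) : (Fin d → ℤ) →+ (Fin d → ℤ) where
  toFun γ := (fun k => if k ∈ e then 0 else γ k) + Pi.single l (∑ k ∈ e, γ k)
  map_zero' := by ext k; simp
  map_add' γ γ' := by
    ext k
    simp only [Pi.add_apply, Finset.sum_add_distrib, Pi.single_add]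
    split_ifs <;> ring

theorem collapse_apply (e : Finset (Fin d)) (l : Fin d) (γ : Fin d → ℤ) :
    collapse e l γ = (fun k => if k ∈ e then 0 else γ k) + Pi.single l (∑ k ∈ e, γ k) :=
  rfl

theorem collapse_single (e : Finset (Fin d)) {j a : Fin d} (ha : a ∈ insert j e) :
    collapse e j (Pi.single a 1) = Pi.single j 1 := by
  rw [collapse_apply]
  by_cases hae : a ∈ e
  · have h1 : (fun k => if k ∈ e then 0 else (Pi.single a 1 : Fin d → ℤ) k) = 0 := by
      ext k
      by_cases hk : k ∈ e
      · simp [hk]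
      · simp [hk, show k ≠ a from fun h => hk (h ▸ hae)]
    rw [h1, zero_add, Finset.sum_pi_single', if_pos hae]
  · obtain rfl : a = j := by simpa [hae] using ha
    have h1 : (fun k => if k ∈ e then 0 else (Pi.single a 1 : Fin d → ℤ) k) = Pi.single a 1 := by
      ext k
      by_cases hk : k ∈ e
      · simp [hk, show k ≠ a from fun h => hae (h ▸ hk)]
      · simp [hk]
    rw [h1, Finset.sum_pi_single', if_neg hae, Pi.single_zero, add_zero]

theorem collapse_eq_zero (e : Finset (Fin d)) {j : Fin d} {γ : Fin d → ℤ}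
    (hγ : γ ∈ diffSubgroup (insert j e)) : collapse e j γ = 0 := by
  have : diffSubgroup (insert j e) ≤ (collapse e j).ker := by
    refine (AddSubgroup.closure_le _).2 ?_
    rintro _ ⟨a, ha, b, hb, rfl⟩
    rw [SetLike.mem_coe, AddMonoidHom.mem_ker, map_sub, collapse_single e ha,
      collapse_single e hb, sub_self]
  exact this hγ

theorem sub_collapse_mem {e : Finset (Fin d)} {i : Fin d} (hi : i ∈ e) (γ : Fin d → ℤ) :
    γ - collapse e i γ ∈ diffSubgroup e := by
  have : γ - collapse e i γ =
      ∑ k ∈ e, γ k • (Pi.single (M := fun _ => ℤ) k 1 - Pi.single i 1) := by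
    ext a
    simp only [collapse_apply, Pi.sub_apply, Pi.add_apply, Finset.sum_apply, Pi.smul_apply,
      smul_eq_mul, mul_sub, Finset.sum_sub_distrib, Pi.single_apply, mul_ite, mul_one, mul_zero,
      Finset.sum_ite_eq]
    by_cases ha : a = i <;> by_cases hae : a ∈ e <;> simp [ha, hae, hi]
  rw [this]
  exact sum_mem fun k hk => (diffSubgroup e).zsmul_mem
    (AddSubgroup.subset_closure ⟨k, hk, i, hi, rfl⟩) _

theorem diffSubgroup_mono {e e' : Finset (Fin d)} (h : e ⊆ e') :
    diffSubgroup e ≤ diffSubgroup e' :=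
  AddSubgroup.closure_mono fun _ ⟨i, hi, l, hl, hv⟩ => ⟨i, h hi, l, h hl, hv⟩

end PPSystem

/-! ### Partially invariant factors and the classes `C_e` -/

namespace PPSystem

open ProbabilityTheory

section InvariantFactor

variable {Γ : Type v} [AddCommGroup Γ] (X : PPSystem.{u} Γ) (Λ : AddSubgroup Γ)

theorem invariantFactor_le : X.invariantFactor Λ ≤ X.mspace := fun _ hs => hs.1

theorem completionIn_invariantFactor_le :
    completionIn X.μ (X.invariantFactor Λ) ≤ X.invariantFactor Λ := by
  rintro s ⟨⟨t, ht, hst⟩, hs⟩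
  exact ⟨hs, fun g hg =>
    ((X.measurePreserving g).quasiMeasurePreserving.preimage_ae_eq hst).trans
      ((ht.2 g hg).trans hst.symm)⟩

theorem invariantFactor_anti {Λ Λ' : AddSubgroup Γ} (h : Λ ≤ Λ') :
    X.invariantFactor Λ' ≤ X.invariantFactor Λ :=
  fun _ hs => ⟨hs.1, fun g hg => hs.2 g (h hg)⟩

/-- As the acting group is abelian, each transformation maps the invariant factor of a subgroup
onto itself. -/
theorem comap_T_invariantFactor (g : Γ) :
    (X.invariantFactor Λ).comap (X.T g) = X.invariantFactor Λ := by
  have hmem : ∀ (g : Γ) (s : Set X.carrier), MeasurableSet[X.invariantFactor Λ] s →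
      MeasurableSet[X.invariantFactor Λ] (X.T g ⁻¹' s) := by
    intro g s hs
    refine ⟨(X.measurePreserving g).measurable hs.1, fun k hk => ?_⟩
    rw [← Set.preimage_comp, ← X.T_add, add_comm, X.T_add, Set.preimage_comp]
    exact (X.measurePreserving g).quasiMeasurePreserving.preimage_ae_eq (hs.2 k hk)
  refine le_antisymm ?_ fun s hs => ?_
  · rintro _ ⟨s, hs, rfl⟩
    exact hmem g s hs
  · refine ⟨X.T (-g) ⁻¹' s, hmem _ _ hs, ?_⟩
    ext x
    simp [T_neg_comp]

/-- The conditional probability of an event given the invariant factor of `Λ` transforms under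
the action of `Γ / Λ`. -/
theorem condExp_invariantFactor_preimage {γ θ : Γ} (h : γ - θ ∈ Λ) {A : Set X.carrier}
    (hA : MeasurableSet A) :
    X.μ[(X.T γ ⁻¹' A).indicator fun _ => (1 : ℝ) | X.invariantFactor Λ] =ᵐ[X.μ]
      X.μ[A.indicator fun _ => (1 : ℝ) | X.invariantFactor Λ] ∘ X.T θ := by
  have hle := X.invariantFactor_le Λ
  have hA1 : Integrable (A.indicator fun _ => (1 : ℝ)) X.μ :=
    (memLp_top_indicator hA).integrable_of_top
  have hγA := (X.measurePreserving γ).measurable hA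
  have hθA := (X.measurePreserving θ).measurable hA
  have h1 := condExp_comp_measurePreserving (X.measurePreserving θ) hle hA1
  rw [comap_T_invariantFactor] at h1
  refine EventuallyEq.trans (EventuallyEq.symm ?_) h1
  have hcomp : (A.indicator fun _ => (1 : ℝ)) ∘ X.T θ =
      (X.T θ ⁻¹' A).indicator fun _ => (1 : ℝ) := rfl
  rw [hcomp]
  refine ae_eq_condExp_of_forall_setIntegral_eq hle
    (memLp_top_indicator hγA).integrable_of_top
    (fun s _ _ => integrable_condExp.integrableOn) (fun B hB _ => ?_)
    stronglyMeasurable_condExp.aestronglyMeasurable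
  rw [setIntegral_condExp hle (memLp_top_indicator hθA).integrable_of_top hB,
    setIntegral_indicator hθA, setIntegral_indicator hγA, setIntegral_const, setIntegral_const]
  congr 1
  have hg := X.measurePreserving (γ - θ)
  rw [measureReal_def, measureReal_def,
    ← hg.measure_preimage ((hB.1.inter hθA).nullMeasurableSet), Set.preimage_inter,
    ← Set.preimage_comp, ← X.T_add, add_sub_cancel]
  congr 1
  exact measure_congr ((hB.2 _ h).inter (ae_eq_refl _))

/-- The regular conditional distribution of a point given the invariant factor of `Λ`. -/
noncomputable def invariantKernel : Kernel X.carrier X.carrier :=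
  (condExpKernel X.μ (X.invariantFactor Λ)).comap id (measurable_id'' (X.invariantFactor_le Λ))

instance : IsMarkovKernel (X.invariantKernel Λ) := by
  unfold invariantKernel; infer_instance

theorem invariantKernel_real_ae_eq {A : Set X.carrier} (hA : MeasurableSet A) :
    (fun x => (X.invariantKernel Λ x).real A) =ᵐ[X.μ]
      X.μ[A.indicator fun _ => (1 : ℝ) | X.invariantFactor Λ] :=
  condExpKernel_ae_eq_condExp (X.invariantFactor_le Λ) hA

theorem invariantKernel_preimage_ae_eq {γ θ : Γ} (h : γ - θ ∈ Λ) {A : Set X.carrier}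
    (hA : MeasurableSet A) :
    (fun x => X.invariantKernel Λ x (X.T γ ⁻¹' A)) =ᵐ[X.μ]
      fun x => X.invariantKernel Λ (X.T θ x) A := by
  have h2 := (X.measurePreserving θ).quasiMeasurePreserving.ae_eq_comp
    (X.invariantKernel_real_ae_eq Λ hA)
  filter_upwards [X.invariantKernel_real_ae_eq Λ ((X.measurePreserving γ).measurable hA),
    X.condExp_invariantFactor_preimage Λ h hA, h2] with x hx1 hx2 hx3
  exact (measureReal_eq_measureReal_iff).1 (hx1.trans (hx2.trans hx3.symm))

theorem setLIntegral_invariantKernel {A B : Set X.carrier}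
    (hA : MeasurableSet[X.invariantFactor Λ] A) (hB : MeasurableSet B) :
    ∫⁻ x in A, X.invariantKernel Λ x B ∂X.μ = X.μ (A ∩ B) := by
  have hle := X.invariantFactor_le Λ
  have hfin : ∫⁻ x in A, X.invariantKernel Λ x B ∂X.μ ≠ ∞ := by
    refine ne_top_of_le_ne_top (measure_ne_top (X.μ.restrict A) Set.univ) ?_
    calc _ ≤ ∫⁻ _ in A, 1 ∂X.μ := lintegral_mono fun x => prob_le_one
      _ = _ := by simp
  rw [← ENNReal.toReal_eq_toReal_iff' hfin (measure_ne_top _ _), ← integral_toReal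
    ((X.invariantKernel Λ).measurable_coe hB).aemeasurable
    (ae_of_all _ fun x => measure_lt_top _ _)]
  have h1 : ∫ x in A, (X.invariantKernel Λ x B).toReal ∂X.μ =
      ∫ x in A, (X.μ[B.indicator fun _ => (1 : ℝ) | X.invariantFactor Λ]) x ∂X.μ :=
    setIntegral_congr_ae hA.1 <| (X.invariantKernel_real_ae_eq Λ hB).mono fun x hx _ => hx
  rw [h1, setIntegral_condExp hle (memLp_top_indicator hB).integrable_of_top hA,
    setIntegral_indicator hB, setIntegral_const, smul_eq_mul, mul_one, measureReal_def]

end InvariantFactor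

section Twisted

variable {Γ : Type v} [AddGroup Γ]

/-- The system with the same space in which the group acts through the endomorphism `φ`. -/
def twist (X : PPSystem.{u} Γ) (φ : Γ →+ Γ) : PPSystem.{u} Γ where
  carrier := X.carrier
  μ := X.μ
  T γ := X.T (φ γ)
  T_zero := by rw [map_zero, X.T_zero]
  T_add g h := by rw [map_add, X.T_add]
  measurePreserving g := X.measurePreserving (φ g)

/-- The system with a single point. -/
noncomputable def point (Γ : Type v) [AddGroup Γ] : PPSystem.{u} Γ where
  carrier := PUnit
  μ := Measure.dirac PUnit.unit
  T _ := id
  T_zero := rfl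
  T_add _ _ := rfl
  measurePreserving _ := MeasurePreserving.id _

theorem isFactorMap_id (X : PPSystem.{u} Γ) : X.IsFactorMap X id :=
  ⟨MeasurePreserving.id _, fun _ => rfl⟩

theorem isFactorMap_point (X : PPSystem.{u} Γ) : X.IsFactorMap (point Γ) fun _ => PUnit.unit :=
  ⟨⟨measurable_const, by
    change X.μ.map (fun _ => PUnit.unit) = Measure.dirac PUnit.unit
    rw [Measure.map_const, measure_univ, one_smul]⟩, fun _ => rfl⟩

/-- A system of one of the classes belongs to their join if the other classes contain the system
with a single point. -/
theorem ClassJoin.of_class {ι : Type*} {C : ι → PPSystem.{u} Γ → Prop}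
    (hC : ∀ i, C i (point Γ)) {Y : PPSystem.{u} Γ} {i : ι} (hY : C i Y) : ClassJoin C Y := by
  have hZ : ∀ k, ∃ (Z : PPSystem.{u} Γ) (π : Y.carrier → Z.carrier), C k Z ∧
      Y.IsFactorMap Z π ∧ (k = i → Y.mspace ≤ Z.mspace.comap π) := by
    intro k
    by_cases hk : k = i
    · exact ⟨Y, id, hk ▸ hY, Y.isFactorMap_id, fun _ => MeasurableSpace.comap_id.ge⟩
    · exact ⟨point Γ, _, hC k, Y.isFactorMap_point, fun h => absurd h hk⟩
  choose Z π h1 h2 h3 using hZ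
  exact ⟨Z, π, h1, h2, fun s hs =>
    ⟨s, le_iSup (fun k => (Z k).mspace.comap (π k)) i _ (h3 i rfl _ hs), ae_eq_refl s⟩⟩

theorem comap_le_maxFactor {C : PPSystem.{u} Γ → Prop} {X Y : PPSystem.{u} Γ} (hY : C Y)
    {π : X.carrier → Y.carrier} (hπ : X.IsFactorMap Y π) :
    Y.mspace.comap π ≤ X.maxFactor C :=
  le_iSup_of_le Y <| le_iSup_of_le hY <| le_iSup_of_le π <| le_iSup_of_le hπ le_rfl

end Twisted

variable {d : ℕ} (X : PPSystem.{u} (Fin d → ℤ))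

/-- In `X`, the maximal factor of the class `C_e` is contained, up to null sets, in the join of the
partially invariant factors of which `C_e` takes the join. -/
theorem maxFactor_classC_le (e : Finset (Fin d)) :
    X.maxFactor (ClassC e) ≤
      completionIn X.μ (⨆ j : {j // j ∉ e}, X.invariantFactor (diffSubgroup (insert j.1 e))) := by
  refine iSup_le fun Y => iSup_le fun hY => iSup_le fun π => iSup_le fun hπ => ?_
  obtain ⟨Z, ρ, hZ, hρ, hgen⟩ := hY
  rintro _ ⟨s, hs, rfl⟩
  obtain ⟨t, ht, hst⟩ := hgen s hs
  refine ⟨⟨π ⁻¹' t, ?_, hπ.measurePreserving.quasiMeasurePreserving.preimage_ae_eq hst⟩,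
    hπ.measurePreserving.measurable hs⟩
  have hle : (⨆ j, (Z j).mspace.comap (ρ j)).comap π ≤
      ⨆ j : {j // j ∉ e}, X.invariantFactor (diffSubgroup (insert j.1 e)) := by
    rw [MeasurableSpace.comap_iSup]
    refine iSup_mono fun j => ?_
    rintro _ ⟨_, ⟨r, hr, rfl⟩, rfl⟩
    have hcomp := (hρ j).measurePreserving.comp hπ.measurePreserving
    refine ⟨hcomp.measurable hr, fun g hg => ?_⟩
    have heq : X.T g ⁻¹' (π ⁻¹' (ρ j ⁻¹' r)) = (ρ j ∘ π) ⁻¹' ((Z j).T g ⁻¹' r) := by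
      ext x
      have h1 := congrFun (hπ.equivariant g) x
      have h2 := congrFun ((hρ j).equivariant g) (π x)
      simp only [Function.comp_apply] at h1 h2
      simp [h1, h2]
    rw [heq]
    refine hcomp.quasiMeasurePreserving.preimage_ae_eq ?_
    exact (hZ j g hg).preimage r
  exact hle _ ⟨t, ht, rfl⟩

theorem twist_collapse_mem_classC {e : Finset (Fin d)} {j : Fin d} (hj : j ∉ e) :
    ClassC e (X.twist (collapse e j)) :=
  ClassJoin.of_class (i := (⟨j, hj⟩ : {j // j ∉ e})) (fun _ _ _ => ae_eq_refl _) fun g hg => by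
    change X.T (collapse e j g) =ᵐ[X.μ] id
    rw [collapse_eq_zero e hg, X.T_zero]

end PPSystem

/-! ### An extension carried by the Furstenberg self-joining -/

namespace PPSystem

open ProbabilityTheory

variable {d : ℕ} {X : PPSystem.{u} (Fin d → ℤ)} {ν : Measure (Fin d → X.carrier)}
  {e : Finset (Fin d)} {i : Fin d}

/-- The relatively independent product of `ν` and `μ` over the invariant factor `Φ_e`, which is
mapped into the first system through the `i`-th coordinate. -/
noncomputable def relProduct (X : PPSystem.{u} (Fin d → ℤ)) (ν : Measure (Fin d → X.carrier))
    (e : Finset (Fin d)) (i : Fin d) : Measure ((Fin d → X.carrier) × X.carrier) :=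
  ν ⊗ₘ ((X.invariantKernel (diffSubgroup e)).comap (fun x => x i) (measurable_pi_apply i))

instance [IsProbabilityMeasure ν] : IsProbabilityMeasure (relProduct X ν e i) := by
  unfold relProduct; infer_instance

theorem relProduct_prod [SFinite ν] {B : Set (Fin d → X.carrier)} (hB : MeasurableSet B)
    {A : Set X.carrier} (hA : MeasurableSet A) :
    relProduct X ν e i (B ×ˢ A) =
      ∫⁻ x in B, X.invariantKernel (diffSubgroup e) (x i) A ∂ν :=
  Measure.compProd_apply_prod hB hA

theorem maxFactor_classC_le_invariantFactor (X : PPSystem.{u} (Fin d → ℤ)) (e : Finset (Fin d)) :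
    X.maxFactor (ClassC e) ≤ X.invariantFactor (diffSubgroup e) := by
  have h : (⨆ j : {j // j ∉ e}, X.invariantFactor (diffSubgroup (insert j.1 e))) ≤
      X.invariantFactor (diffSubgroup e) :=
    iSup_le fun j => X.invariantFactor_anti (diffSubgroup_mono (Finset.subset_insert j.1 e))
  have h' := completionIn_le_completionIn (h.trans (le_completionIn (μ := X.μ)
    (X.invariantFactor_le _)))
  exact (X.maxFactor_classC_le e).trans (h'.trans (X.completionIn_invariantFactor_le _))

namespace IsFurstenbergSelfJoining

theorem measurePreserving_collapse (h : X.IsFurstenbergSelfJoining ν) (e : Finset (Fin d))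
    (γ : Fin d → ℤ) :
    MeasurePreserving (fun (x : Fin d → X.carrier) l => X.T (collapse e l γ) (x l)) ν ν :=
  h.measurePreserving_shift (fun k => if k ∈ e then 0 else γ k) (∑ k ∈ e, γ k)

/-- The relatively independent product is invariant, because the actions on the coordinate `i` and on
`X` agree modulo `diffSubgroup e` and hence act on `Φ_e` in the same way. -/
theorem measurePreserving_relProduct (h : X.IsFurstenbergSelfJoining ν) (hi : i ∈ e)
    (γ : Fin d → ℤ) :
    MeasurePreserving (fun z : (Fin d → X.carrier) × X.carrier =>
      ((fun l => X.T (collapse e l γ) (z.1 l)), X.T γ z.2))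
      (relProduct X ν e i) (relProduct X ν e i) := by
  have := h.prob
  have hS := h.measurePreserving_collapse e γ
  have hT := X.measurePreserving γ
  have hmeas : Measurable fun z : (Fin d → X.carrier) × X.carrier =>
      ((fun l => X.T (collapse e l γ) (z.1 l)), X.T γ z.2) :=
    (hS.measurable.comp measurable_fst).prodMk (hT.measurable.comp measurable_snd)
  refine ⟨hmeas, Measure.ext_prod fun {B A} hB hA => ?_⟩
  rw [Measure.map_apply hmeas (hB.prod hA)]
  change relProduct X ν e i
    (((fun (x : Fin d → X.carrier) l => X.T (collapse e l γ) (x l)) ⁻¹' B) ×ˢ (X.T γ ⁻¹' A)) = _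
  rw [relProduct_prod (hS.measurable hB) (hT.measurable hA), relProduct_prod hB hA]
  have hpull := hS.setLIntegral_comp_preimage hB
    (((X.invariantKernel (diffSubgroup e)).measurable_coe hA).comp
      (h.measurePreserving_eval i).measurable)
  refine Eq.trans (setLIntegral_congr_fun_ae (hS.measurable hB) ?_) hpull
  have hae := (h.measurePreserving_eval i).quasiMeasurePreserving.ae_eq_comp
    (X.invariantKernel_preimage_ae_eq (diffSubgroup e) (sub_collapse_mem hi γ) hA)
  filter_upwards [hae] with x hx _ using hx

theorem measurePreserving_snd (h : X.IsFurstenbergSelfJoining ν) (e : Finset (Fin d))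
    (i : Fin d) : MeasurePreserving Prod.snd (relProduct X ν e i) X.μ := by
  have := h.prob
  refine ⟨measurable_snd, Measure.ext fun A hA => ?_⟩
  rw [Measure.map_apply measurable_snd hA, ← Set.univ_prod, relProduct_prod .univ hA,
    Measure.restrict_univ, (h.measurePreserving_eval i).lintegral_comp
      ((X.invariantKernel (diffSubgroup e)).measurable_coe hA), ← setLIntegral_univ,
    setLIntegral_invariantKernel _ _ .univ hA, Set.univ_inter]

theorem measurePreserving_fst (h : X.IsFurstenbergSelfJoining ν) (e : Finset (Fin d))
    (i : Fin d) : MeasurePreserving Prod.fst (relProduct X ν e i) ν := by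
  have := h.prob
  exact ⟨measurable_fst, Measure.fst_compProd _ _⟩

/-- The two maps of the relatively independent product to the common factor `Φ_e` agree. -/
theorem relProduct_preimage_ae_eq (h : X.IsFurstenbergSelfJoining ν) {A : Set X.carrier}
    (hA : MeasurableSet[X.invariantFactor (diffSubgroup e)] A) :
    (fun z : (Fin d → X.carrier) × X.carrier => z.2) ⁻¹' A =ᵐ[relProduct X ν e i]
      (fun z => z.1 i) ⁻¹' A := by
  have := h.prob
  have key : ∀ A B : Set X.carrier, MeasurableSet[X.invariantFactor (diffSubgroup e)] A →
      MeasurableSet B → A ∩ B = ∅ →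
      relProduct X ν e i (((fun x : Fin d → X.carrier => x i) ⁻¹' A) ×ˢ B) = 0 := by
    intro A B hA hB hAB
    have hev := h.measurePreserving_eval i
    rw [relProduct_prod (hev.measurable hA.1) hB, hev.setLIntegral_comp_preimage hA.1
      ((X.invariantKernel (diffSubgroup e)).measurable_coe hB),
      setLIntegral_invariantKernel _ _ hA hB, hAB, measure_empty]
  refine (ae_le_set.2 ?_).antisymm (ae_le_set.2 ?_)
  · refine measure_mono_null ?_ (key Aᶜ A hA.compl hA.1 (Set.compl_inter_self A))
    exact fun z hz => ⟨hz.2, hz.1⟩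
  · refine measure_mono_null ?_ (key A Aᶜ hA hA.1.compl (Set.inter_compl_self A))
    exact fun z hz => ⟨hz.1, hz.2⟩

/-- The extension of `X` to the relatively independent product of the Furstenberg self-joining
and `X` over `Φ_e`. The vectors `𝐞_k`, `k ∈ e`, act on the self-joining as
`T^{𝐞_1} × ⋯ × T^{𝐞_d}` and the other basis vectors act diagonally, so that `𝐞_k - 𝐞_j` acts
trivially on the `j`-th coordinate if `k ∈ e` and `j ∉ e`. -/
noncomputable def extension (h : X.IsFurstenbergSelfJoining ν) (hi : i ∈ e) :
    PPSystem.{u} (Fin d → ℤ) where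
  carrier := (Fin d → X.carrier) × X.carrier
  μ := relProduct X ν e i
  prob := by
    have := h.prob
    infer_instance
  T γ z := ((fun l => X.T (collapse e l γ) (z.1 l)), X.T γ z.2)
  T_zero := by
    ext z <;> simp [X.T_zero]
  T_add γ γ' := by
    funext z
    simp [X.T_add]
  measurePreserving := h.measurePreserving_relProduct hi

theorem extension_isFactorMap (h : X.IsFurstenbergSelfJoining ν) (hi : i ∈ e) :
    (h.extension hi).IsFactorMap X Prod.snd :=
  ⟨h.measurePreserving_snd e i, fun _ => rfl⟩

theorem extension_isFactorMap_twist (h : X.IsFurstenbergSelfJoining ν) (hi : i ∈ e) (j : Fin d) :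
    (h.extension hi).IsFactorMap (X.twist (collapse e j)) fun z => z.1 j :=
  ⟨(h.measurePreserving_eval j).comp (h.measurePreserving_fst e i), fun _ => rfl⟩

/-- The coordinates outside `e` generate part of the maximal `C_e`-factor of the extension. -/
theorem comap_fst_le_maxFactor (h : X.IsFurstenbergSelfJoining ν) (hi : i ∈ e) :
    (⨆ j : {j // j ∉ e}, X.mspace.comap fun x : Fin d → X.carrier => x j.1).comap
        (Prod.fst : (Fin d → X.carrier) × X.carrier → _) ≤
      (h.extension hi).maxFactor (ClassC e) := by
  rw [MeasurableSpace.comap_iSup]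
  refine iSup_le fun j => ?_
  rw [MeasurableSpace.comap_comp]
  exact comap_le_maxFactor (X.twist_collapse_mem_classC j.2) (h.extension_isFactorMap_twist hi j.1)

/-- Satedness for the extension by the relatively independent product: on the coordinates outside
`e`, an event of `Φ_e` in the coordinate `i ∈ e` may be replaced by its conditional probability
given the maximal `C_e`-factor. -/
theorem setIntegral_condExp_maxFactor (h : X.IsFurstenbergSelfJoining ν) (hi : i ∈ e)
    (hX : X.IsSated (ClassC e)) {A : Set X.carrier}
    (hA : MeasurableSet[X.invariantFactor (diffSubgroup e)] A) {B : Set (Fin d → X.carrier)}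
    (hB : MeasurableSet[⨆ j : {j // j ∉ e}, X.mspace.comap fun x : Fin d → X.carrier => x j.1] B) :
    ∫ x in B, (X.μ[A.indicator fun _ => (1 : ℝ) | X.maxFactor (ClassC e)]) (x i) ∂ν =
      ∫ x in B, A.indicator (fun _ => (1 : ℝ)) (x i) ∂ν := by
  have := h.prob
  let F : X.carrier → ℝ := A.indicator fun _ => 1
  have hMΦ := maxFactor_classC_le_invariantFactor X e
  have hM := hMΦ.trans (X.invariantFactor_le _)
  have hB₀ : MeasurableSet B := by
    refine (iSup_le fun j => ?_ : (⨆ j : {j // j ∉ e}, X.mspace.comap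
      fun x : Fin d → X.carrier => x j.1) ≤ MeasurableSpace.pi) _ hB
    exact (h.measurePreserving_eval j.1).measurable.comap_le
  have hsnd := h.measurePreserving_snd e i
  have hfst := h.measurePreserving_fst e i
  have hF : MemLp F ∞ X.μ := memLp_top_indicator hA.1
  have hF2 : MemLp (F ∘ Prod.snd) ∞ (relProduct X ν e i) := hF.comp_measurePreserving hsnd
  let G : (Fin d → X.carrier) × X.carrier → ℝ := (Prod.fst ⁻¹' B).indicator fun _ => 1
  have hG : MemLp G ∞ (relProduct X ν e i) := memLp_top_indicator (hfst.measurable hB₀)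
  obtain ⟨hle, -, hsat⟩ := hX (h.extension hi) Prod.snd (h.extension_isFactorMap hi)
  have hFm : Measurable[X.invariantFactor (diffSubgroup e)] F := measurable_const.indicator hA
  have hGm : Measurable[(h.extension hi).maxFactor (ClassC e)] G :=
    measurable_const.indicator (h.comap_fst_le_maxFactor hi _ ⟨B, hB, rfl⟩)
  have hsat := hsat (F ∘ Prod.snd) G
    ((hFm.mono (X.invariantFactor_le _) le_rfl).comp (comap_measurable _)) hGm hF2 hG
  -- Integrals over the extension against `G` are integrals over `B` of the first marginal.
  have hint : ∀ f : X.carrier → ℝ, Measurable[X.invariantFactor (diffSubgroup e)] f →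
      ∫ z, (f ∘ Prod.snd) z * G z ∂(relProduct X ν e i) = ∫ x in B, f (x i) ∂ν := by
    intro f hf
    have h1 := ae_eq_comp_of_preimage_ae_eq
      (fun A hA => h.relProduct_preimage_ae_eq (e := e) (i := i) hA) hf
    have hfi : Measurable fun x : Fin d → X.carrier => f (x i) :=
      (hf.mono (X.invariantFactor_le _) le_rfl).comp (h.measurePreserving_eval i).measurable
    have h2 : ∫ x in B, f (x i) ∂ν =
        ∫ z in Prod.fst ⁻¹' B, f (z.1 i) ∂(relProduct X ν e i) := by
      conv_lhs => rw [← hfst.map_eq]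
      exact setIntegral_map hB₀ (hfi.aestronglyMeasurable) hfst.measurable.aemeasurable
    rw [h2, ← integral_indicator (hfst.measurable hB₀)]
    refine integral_congr_ae ?_
    filter_upwards [h1] with z hz
    by_cases hzB : z.1 ∈ B
    · simpa [G, Set.indicator_of_mem, hzB] using hz
    · simp [G, Set.indicator_of_notMem, hzB]
  have hΞ : (X.maxFactor (ClassC e)).comap Prod.snd ≤
      (inferInstance : MeasurableSpace ((Fin d → X.carrier) × X.carrier)) :=
    hle.trans hsnd.measurable.comap_le
  have hc := condExp_comp_measurePreserving hsnd hM hF.integrable_of_top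
  have h3 := integral_condExp_mul hΞ hG.integrable_of_top
    (stronglyMeasurable_condExp (m := (X.maxFactor (ClassC e)).comap Prod.snd)
      (f := F ∘ Prod.snd) (μ := relProduct X ν e i)).aestronglyMeasurable
    (hG.mul_top (hF2.condExp le_top)).integrable_of_top
  rw [← hint _ (stronglyMeasurable_condExp.mono hMΦ).measurable]
  refine Eq.trans ?_ (hint F hFm)
  refine Eq.trans ?_ hsat.symm
  simp only [mul_comm] at h3 ⊢
  refine Eq.trans ?_ h3.symm
  refine integral_congr_ae ?_
  filter_upwards [hc] with z hz
  exact congrArg (· * G z) hz.symm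

end IsFurstenbergSelfJoining

end PPSystem

/-! ### Relative independence of oblique factors -/

namespace PPSystem

variable {d : ℕ} {X : PPSystem.{u} (Fin d → ℤ)}

section Oblique

theorem obliqueFactor_le (X : PPSystem.{u} (Fin d → ℤ)) (I : Set (Finset (Fin d))) :
    X.obliqueFactor I ≤ MeasurableSpace.pi :=
  iSup₂_le fun _ _ => completionIn_le

theorem obliqueCopy_le_obliqueFactor {I : Set (Finset (Fin d))} {e : Finset (Fin d)} (he : e ∈ I) :
    X.obliqueCopy e ≤ X.obliqueFactor I :=
  le_iSup₂ (f := fun e (_ : e ∈ I) => X.obliqueCopy e) e he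

theorem obliqueFactor_mono {I I' : Set (Finset (Fin d))} (h : I ⊆ I') :
    X.obliqueFactor I ≤ X.obliqueFactor I' :=
  iSup₂_le fun _ he => obliqueCopy_le_obliqueFactor (h he)

theorem obliqueFactor_insert (e : Finset (Fin d)) (I : Set (Finset (Fin d))) :
    X.obliqueFactor (insert e I) = X.obliqueFactor I ⊔ X.obliqueCopy e := by
  rw [obliqueFactor, iSup_insert, sup_comm]
  rfl

theorem comap_le_obliqueCopy
    (h : X.IsFurstenbergSelfJoining X.furstenbergSelfJoining)
    {e : Finset (Fin d)} {i : Fin d} (hi : i ∈ e) :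
    (X.invariantFactor (diffSubgroup e)).comap (fun x : Fin d → X.carrier => x i) ≤
      X.obliqueCopy e := by
  refine le_trans (le_iSup₂ (f := fun i (_ : i ∈ e) => (X.invariantFactor (diffSubgroup e)).comap
    fun x : Fin d → X.carrier => x i) i hi) (le_completionIn (iSup₂_le fun j _ => ?_))
  exact (MeasurableSpace.comap_mono (X.invariantFactor_le _)).trans
    (h.measurePreserving_eval j).measurable.comap_le

theorem obliqueCopy_le_completionIn_comap
    (h : X.IsFurstenbergSelfJoining X.furstenbergSelfJoining)
    {e : Finset (Fin d)} {i : Fin d} (hi : i ∈ e) :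
    X.obliqueCopy e ≤ completionIn X.furstenbergSelfJoining
      ((X.invariantFactor (diffSubgroup e)).comap fun x : Fin d → X.carrier => x i) := by
  refine completionIn_le_completionIn (iSup₂_le fun j hj => ?_)
  rintro _ ⟨A, hA, rfl⟩
  exact ⟨⟨_, ⟨A, hA, rfl⟩, h.preimage_ae_eq hj hi hA⟩,
    (h.measurePreserving_eval j).measurable hA.1⟩

/-- If no member of `I` is contained in `e`, then the oblique factor of `I` is carried by the
coordinates outside `e`. -/
theorem obliqueFactor_le_completionIn
    (h : X.IsFurstenbergSelfJoining X.furstenbergSelfJoining)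
    {I : Set (Finset (Fin d))} {e : Finset (Fin d)}
    (hI : ∀ a ∈ I, ¬ a ⊆ e) :
    X.obliqueFactor I ≤ completionIn X.furstenbergSelfJoining
      (⨆ j : {j // j ∉ e}, X.mspace.comap fun x : Fin d → X.carrier => x j.1) := by
  refine iSup₂_le fun a ha => ?_
  obtain ⟨j, hja, hje⟩ := Finset.not_subset.1 (hI a ha)
  refine (obliqueCopy_le_completionIn_comap h hja).trans (completionIn_le_completionIn ?_)
  refine (MeasurableSpace.comap_mono (X.invariantFactor_le _)).trans ?_
  refine le_trans (le_iSup (fun j : {j // j ∉ e} => X.mspace.comap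
    fun x : Fin d → X.carrier => x j.1) ⟨j, hje⟩) (le_completionIn (iSup_le fun j => ?_))
  exact (h.measurePreserving_eval j.1).measurable.comap_le

/-- If `J` contains all the sets `e ∪ {j}`, `j ∉ e`, then the copy of the maximal `C_e`-factor
in a coordinate `i ∈ e` is contained in the oblique factor of `J`, up to null sets. -/
theorem comap_maxFactor_le_completionIn
    (h : X.IsFurstenbergSelfJoining X.furstenbergSelfJoining)
    {J : Set (Finset (Fin d))} {e : Finset (Fin d)} {i : Fin d}
    (hi : i ∈ e) (hJ : ∀ j ∉ e, insert j e ∈ J) :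
    (X.maxFactor (ClassC e)).comap (fun x : Fin d → X.carrier => x i) ≤
      completionIn X.furstenbergSelfJoining (X.obliqueFactor J) := by
  refine (MeasurableSpace.comap_mono (X.maxFactor_classC_le e)).trans
    ((comap_completionIn_le (h.measurePreserving_eval i)).trans (completionIn_le_completionIn ?_))
  rw [MeasurableSpace.comap_iSup]
  refine iSup_le fun j => ?_
  exact ((comap_le_obliqueCopy h (Finset.mem_insert_of_mem hi)).trans
    (obliqueCopy_le_obliqueFactor (hJ j.1 j.2))).trans
      (le_completionIn (X.obliqueFactor_le J))

/-- The case of one oblique copy: if no member of `I` is contained in `e` and `J ⊆ I` contains all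
the sets `e ∪ {j}`, `j ∉ e`, then the oblique copy of `Φ_e` is relatively independent from the
oblique factor of `I` over that of `J`. -/
theorem condExp_obliqueCopy_indicator
    (h : X.IsFurstenbergSelfJoining X.furstenbergSelfJoining)
    {I J : Set (Finset (Fin d))} {e : Finset (Fin d)}
    (he : e.Nonempty) (hX : X.IsSated (ClassC e)) (hI : ∀ a ∈ I, ¬ a ⊆ e) (hJI : J ⊆ I)
    (hJ : ∀ j ∉ e, insert j e ∈ J) {A : Set (Fin d → X.carrier)}
    (hA : MeasurableSet[X.obliqueCopy e] A) :
    X.furstenbergSelfJoining[A.indicator fun _ => (1 : ℝ) | X.obliqueFactor I]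
      =ᵐ[X.furstenbergSelfJoining]
    X.furstenbergSelfJoining[A.indicator fun _ => (1 : ℝ) | X.obliqueFactor J] := by
  have := h.prob
  obtain ⟨i, hi⟩ := he
  obtain ⟨⟨_, ⟨A', hA', rfl⟩, hAA'⟩, -⟩ := obliqueCopy_le_completionIn_comap h hi _ hA
  have hA₀ : MeasurableSet A := completionIn_le _ hA
  have hev := h.measurePreserving_eval i
  have hJ₀ := X.obliqueFactor_le J
  have hI₀ := X.obliqueFactor_le I
  let F : X.carrier → ℝ := A'.indicator fun _ => 1
  let k : (Fin d → X.carrier) → ℝ := X.μ[F | X.maxFactor (ClassC e)] ∘ fun x => x i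
  have hki : Integrable k X.furstenbergSelfJoining := hev.integrable_comp_of_integrable
    integrable_condExp
  have hAi : Integrable (A.indicator fun _ => (1 : ℝ)) X.furstenbergSelfJoining :=
    (memLp_top_indicator hA₀).integrable_of_top
  have hAF : A.indicator (fun _ => (1 : ℝ)) =ᵐ[X.furstenbergSelfJoining] fun x => F (x i) :=
    indicator_ae_eq_of_ae_eq_set hAA'
  have hkJ : AEStronglyMeasurable[X.obliqueFactor J] k X.furstenbergSelfJoining := by
    have hk : StronglyMeasurable[(X.maxFactor (ClassC e)).comap fun x => x i] k :=
      stronglyMeasurable_condExp.comp_measurable (comap_measurable _)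
    exact aestronglyMeasurable_of_completionIn hJ₀
      (hk.mono (comap_maxFactor_le_completionIn h hi hJ)) hki
  -- Both functions have the same integral over events in the coordinates outside `e`, and these
  -- exhaust the oblique factor of `I` up to null sets.
  have hIk : k =ᵐ[X.furstenbergSelfJoining]
      X.furstenbergSelfJoining[A.indicator fun _ => (1 : ℝ) | X.obliqueFactor I] := by
    refine ae_eq_condExp_of_forall_setIntegral_eq hI₀ hAi (fun s _ _ => hki.integrableOn)
      (fun B hB _ => ?_) (hkJ.mono (obliqueFactor_mono hJI))
    obtain ⟨⟨B', hB', hBB'⟩, -⟩ := obliqueFactor_le_completionIn h hI _ hB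
    rw [setIntegral_congr_set hBB', setIntegral_congr_set hBB',
      integral_congr_ae (ae_restrict_of_ae hAF)]
    exact h.setIntegral_condExp_maxFactor hi hX hA' hB'
  exact hIk.symm.trans ((condExp_of_aestronglyMeasurable' hJ₀ hkJ hki).symm.trans
    ((condExp_congr_ae hIk).trans (condExp_condExp_of_le (obliqueFactor_mono hJI) hI₀)))

/-- Relative independence of oblique factors, in terms of conditional expectations. The proof
enlarges `I'` by a maximal element of `I \ I'` and uses induction on the number of elements that
are missing. -/
theorem condExp_obliqueFactor_inter
    (h : X.IsFurstenbergSelfJoining X.furstenbergSelfJoining)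
    (hX : ∀ e : Finset (Fin d), e.Nonempty → X.IsSated (ClassC e)) {I : Set (Finset (Fin d))}
    (hI : IsUpSetGeTwo I) {I' : Set (Finset (Fin d))} (hI' : IsUpSetGeTwo I')
    {f : (Fin d → X.carrier) → ℝ}
    (hfm : AEStronglyMeasurable[X.obliqueFactor I'] f X.furstenbergSelfJoining)
    (hf : MemLp f ∞ X.furstenbergSelfJoining) :
    X.furstenbergSelfJoining[f | X.obliqueFactor I] =ᵐ[X.furstenbergSelfJoining]
      X.furstenbergSelfJoining[f | X.obliqueFactor (I ∩ I')] := by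
  have := h.prob
  induction hn : (I \ I').ncard using Nat.strong_induction_on generalizing I' with
  | _ n ih =>
  subst hn
  rcases (I \ I').eq_empty_or_nonempty with hempty | hne
  · rw [Set.inter_eq_left.2 (Set.sdiff_eq_empty.1 hempty)]
  obtain ⟨e, he⟩ := (Set.toFinite (I \ I')).exists_maximal hne
  have heI : e ∈ I := he.prop.1
  have heI' : e ∉ I' := he.prop.2
  -- By maximality of `e`, all proper supersets of `e` belong to `I'`.
  have hsup : ∀ a, e ⊂ a → a ∈ I' := by
    intro a ha
    by_contra haI'
    exact ha.2 (he.le_of_ge ⟨hI.2 e heI a ha.1, haI'⟩ ha.1)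
  have hup : IsUpSetGeTwo (insert e I') := by
    refine ⟨?_, ?_⟩
    · rintro a (rfl | ha)
      · exact hI.1 _ heI
      · exact hI'.1 a ha
    · rintro a (rfl | ha) b hab
      · rcases eq_or_ssubset_of_subset hab with rfl | hab
        · exact Set.mem_insert _ _
        · exact Set.mem_insert_of_mem _ (hsup b hab)
      · exact Set.mem_insert_of_mem _ (hI'.2 a ha b hab)
  have hcard : (I \ insert e I').ncard < (I \ I').ncard := by
    refine Set.ncard_lt_ncard ⟨Set.sdiff_subset_sdiff_right (Set.subset_insert _ _), fun hsub => ?_⟩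
      (Set.toFinite _)
    exact (hsub he.prop).2 (Set.mem_insert _ _)
  have hstep := ih _ hcard hup
    (hfm.mono (obliqueFactor_mono (Set.subset_insert _ _))) rfl
  rw [Set.inter_insert_of_mem heI, obliqueFactor_insert] at hstep
  have hene : e.Nonempty := Finset.card_pos.1 (by have := hI.1 e heI; omega)
  refine hstep.trans (condExp_sup_ae_eq_of_forall_indicator
    (obliqueFactor_mono Set.inter_subset_right) (X.obliqueFactor_le I') completionIn_le
    (fun A hA => condExp_obliqueCopy_indicator h hene (hX e hene)
      (fun a ha hae => heI' (hI'.2 a ha e hae)) Set.inter_subset_right (fun j hj => ?_) hA) hfm hf)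
  have hss : e ⊂ insert j e := Finset.ssubset_insert hj
  exact ⟨hI.2 e heI _ hss.1, hsup _ hss⟩

end Oblique

end PPSystem

theorem mainTheorem8 {d : ℕ} (X : PPSystem.{u} (Fin d → ℤ))
    (hX : ∀ e : Finset (Fin d), e.Nonempty → X.IsSated (PPSystem.ClassC e))
    (I I' : Set (Finset (Fin d))) (hI : PPSystem.IsUpSetGeTwo I)
    (hI' : PPSystem.IsUpSetGeTwo I') :
    RelIndepOver X.furstenbergSelfJoining
      (X.obliqueFactor I) (X.obliqueFactor I') (X.obliqueFactor (I ∩ I')) := by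
  have h₁ := PPSystem.obliqueFactor_mono (X := X) (Set.inter_subset_left : I ∩ I' ⊆ I)
  have h₂ := PPSystem.obliqueFactor_mono (X := X) (Set.inter_subset_right : I ∩ I' ⊆ I')
  by_cases hex : ∃ ν, X.IsFurstenbergSelfJoining ν
  · obtain ⟨ν, hν⟩ := hex
    have h : X.IsFurstenbergSelfJoining X.furstenbergSelfJoining := by
      rwa [hν.furstenbergSelfJoining_eq]
    have := h.prob
    exact RelIndepOver.of_condExp_ae_eq h₁ h₂ (X.obliqueFactor_le I) fun f hfm hf =>
      PPSystem.condExp_obliqueFactor_inter h hX hI hI' hfm hf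
  -- As the averages converge for every system, this case does not occur. Excluding it would take
  -- that convergence theorem, whereas the measure that `furstenbergSelfJoining` takes here is zero.
  · refine ⟨h₁, h₂, fun f₁ f₂ _ _ _ _ => ?_⟩
    have h0 : X.furstenbergSelfJoining = 0 := dif_neg hex
    simp [h0]
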